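/- Let $Z, Z_1, Z_2, \dots$ be independent, identically distributed real random variables with $0<\mathbb E Z<\infty$ whose law is non-arithmetic, i.e. the support of the law is not contained in $d\mathbb Z$ for any $d\in\mathbb R$. Put $S_0=0$, $S_n=Z_1+\dots+Z_n$, and let $H(B)=\sum_{n=0}^\infty \mathbb P(S_n\in B)$, for Borel $B\subseteq\mathbb R$, be the renewal measure. Let $L:(0,\infty)\to(0,\infty)$ be a slowly varying function, i.e. $L$ is Borel measurable and $\lim_{x\to\infty}L(\lambda x)/L(x)=1$ for every $\lambda>0$, and assume that $L$ is bounded on $[1,b]$ for every $b>1$. Assume that $\widetilde L(x)=\int_0^x \frac{L(t)}{t}\,dt$ is finite for every $x>0$ and that $\widetilde L(x)\to\infty$ as $x\to\infty$. Then $\int_{(0,x]}L(e^{x-z})\,dH(z)$ is finite for every $x\in\mathbb R$, and $$\int_{(0,x]} L(e^{x-z})\,dH(z)\ \sim\ \frac{\widetilde L(e^x)}{\mathbb E Z}\qquad\text{as } x\to\infty,$$ that is, the ratio of the two sides tends to $1$. -/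

import Mathlib

open MeasureTheory ProbabilityTheory Set Filter Topology Asymptotics

/-- A Borel measurable function `f : (0,∞) → (0,∞)` (only the values of `f` on `(0,∞)` matter) is
regularly varying with index `ρ` if `f (c x) / f x → c ^ ρ` as `x → ∞`, for every `c > 0`. -/
structure IsRegularlyVarying (f : ℝ → ℝ) (ρ : ℝ) : Prop where
  measurable_restrict : Measurable ((Ioi (0 : ℝ)).domRestrict f)
  pos : ∀ x : ℝ, 0 < x → 0 < f x
  tendsto_ratio : ∀ c : ℝ, 0 < c → Tendsto (fun x : ℝ => f (c * x) / f x) atTop (𝓝 (c ^ ρ))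

/-- Slowly varying functions: regularly varying with index `0`. -/
def IsSlowlyVarying (f : ℝ → ℝ) : Prop := IsRegularlyVarying f 0

/-- The de Haan function `x ↦ ∫₀ˣ L(t)/t dt` (used for `x > 0`). -/
noncomputable def deHaan (L : ℝ → ℝ) (x : ℝ) : ℝ := ∫ t in Ioc 0 x, L t / t

/-- A law on `ℝ` is arithmetic if its support is contained in `d ℤ` for some real `d`. -/
def IsArithmetic (μ : Measure ℝ) : Prop :=
  ∃ d : ℝ, μ.support ⊆ {y : ℝ | ∃ k : ℤ, y = k * d}

/-- The partial sums `S₀ = 0`, `Sₙ = Z₁ + ⋯ + Zₙ`; the sequence `Z₁, Z₂, …` is indexed from `0`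
here. -/
def partialSum {Ω : Type*} (Z : ℕ → Ω → ℝ) (n : ℕ) (ω : Ω) : ℝ := ∑ i ∈ Finset.range n, Z i ω

/-- The renewal measure `H(B) = ∑ₙ P(Sₙ ∈ B)`, the sum being over `n ≥ 0`. -/
noncomputable def renewalMeasure {Ω : Type*} [MeasurableSpace Ω] (P : Measure Ω)
    (Z : ℕ → Ω → ℝ) : Measure ℝ :=
  Measure.sum fun n : ℕ => P.map (partialSum Z n)

/-!
In additive notation put `f y = L (exp y)` for `0 ≤ y`, `f y = 0` for `y < 0`, and
`F x = ∫ y in 0..x, f y`, which is `deHaan L (exp x) - deHaan L 1` and so tends to infinity. With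
`g t = f (x - t)` for `0 < t` and `g t = 0` otherwise (`reflectCut f x`), and
`J x w = ∫ g (s + w) dH(s)`, the claim is `J x 0 ∼ F x / E Z`. Local regularity of `H` as in
Blackwell's theorem is not needed, since `f` is nearly constant over bounded distances; a
telescoping identity gives the right constant, and only a uniform bound for `H` is required besides.

* The identity (`intervalIntegral_eq_integral_renewalMeasure`). For `G s = ∫ t in s..x, g t` the
  increments `G (S n) - G (S (n + 1))` telescope to `G 0 = F x`, because `S n → ∞`. Each of them is
  the integral of `Z * g (S n + v * Z)` over `v` in `(0, 1]`, where `Z` is the next step.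
  Summing over `n` gives `F x = E[Z * J x (V * Z)]` with `V` uniform in `(0, 1]` and independent of `Z`.
* The bound for `H` (`exists_renewalMeasure_Icc_le`). By the strong law of large numbers,
  `H [a, a + h]` is bounded in `a`.
* Consequences for `J`. A measurable slowly varying function changes at most by a constant factor
  over unit distances (`exists_forall_le_four_mul`), so that it is dominated by its averages over
  unit intervals; hence `J x w ≤ A + D * F x` uniformly in `w`
  (`exists_integral_reflectCut_le`), and `f x = o(F x)` (`eventually_le_mul_integral`). For fixed `w`
  this yields `J x w - J x 0 = o(F x)` (`isLittleO_integral_reflectCut_sub`).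

After division by `F x`, dominated convergence in the identity, with dominating function a multiple
of `|Z|`, gives `1 - E Z * J x 0 / F x → 0`.
-/

/-! ### Random walks with positive drift and the bound for the renewal measure -/

section RandomWalk

variable {Ω : Type*} [MeasurableSpace Ω] {P : Measure Ω} {Z : ℕ → Ω → ℝ}

lemma measurable_partialSum (hZ : ∀ i, Measurable (Z i)) (n : ℕ) : Measurable (partialSum Z n) := by
  unfold partialSum
  exact Finset.measurable_sum _ fun i _ => hZ i

lemma partialSum_add {Ω : Type*} (Z : ℕ → Ω → ℝ) (n m : ℕ) (ω : Ω) :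
    partialSum Z (n + m) ω = partialSum Z n ω + partialSum (fun i => Z (n + i)) m ω := by
  simp [partialSum, Finset.sum_range_add]

/-- By the strong law of large numbers, a random walk with positive drift tends to infinity. -/
lemma ae_tendsto_partialSum_atTop (hZ_indep : iIndepFun Z P)
    (hZ_ident : ∀ i, IdentDistrib (Z i) (Z 0) P P) (hZ_int : Integrable (Z 0) P)
    (hZ_pos : 0 < ∫ ω, Z 0 ω ∂P) :
    ∀ᵐ ω ∂P, Tendsto (fun n => partialSum Z n ω) atTop atTop := by
  filter_upwards [strong_law_ae_real Z hZ_int (fun i j hij => hZ_indep.indepFun hij) hZ_ident]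
    with ω hω
  refine (hω.pos_mul_atTop hZ_pos tendsto_natCast_atTop_atTop).congr' ?_
  filter_upwards [eventually_gt_atTop 0] with n hn
  have : (n : ℝ) ≠ 0 := by positivity
  rw [div_mul_cancel₀ _ this, partialSum]

/-- The walk restarted at time `n` has the same law as the original walk. -/
lemma measure_shift_eq [IsProbabilityMeasure P] (hZ_meas : ∀ i, Measurable (Z i))
    (hZ_indep : iIndepFun Z P)
    (hZ_ident : ∀ i, IdentDistrib (Z i) (Z 0) P P) (n : ℕ) {A : Set (ℕ → ℝ)}
    (hA : MeasurableSet A) :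
    P {ω | (fun i => Z (n + i) ω) ∈ A} = P {ω | (fun i => Z i ω) ∈ A} := by
  have h1 := iIndepFun.map_fun_eq_infinitePi_map hZ_meas hZ_indep
  have h2 := iIndepFun.map_fun_eq_infinitePi_map (X := fun i => Z (n + i))
    (fun i => hZ_meas _) (hZ_indep.precomp (add_right_injective n))
  have h3 : (fun i => P.map (Z (n + i))) = fun i => P.map (Z i) := by
    funext i
    rw [(hZ_ident _).map_eq, (hZ_ident i).map_eq]
  have h4 : P.map (fun ω i => Z (n + i) ω) = P.map (fun ω i => Z i ω) := by
    rw [h1, h2, h3]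
  have h5 : P.map (fun ω i => Z (n + i) ω) A = P.map (fun ω i => Z i ω) A := by rw [h4]
  rwa [Measure.map_apply (measurable_pi_iff.2 fun i => hZ_meas _) hA,
    Measure.map_apply (measurable_pi_iff.2 fun i => hZ_meas _) hA] at h5

/-- The position at time `n` is independent of any event about the walk restarted at time `n`. -/
lemma measure_inter_shift [IsProbabilityMeasure P] (hZ_meas : ∀ i, Measurable (Z i))
    (hZ_indep : iIndepFun Z P) (n : ℕ) {B : Set ℝ} (hB : MeasurableSet B) {A : Set (ℕ → ℝ)}
    (hA : MeasurableSet A) :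
    P ({ω | partialSum Z n ω ∈ B} ∩ {ω | (fun i => Z (n + i) ω) ∈ A}) =
      P {ω | partialSum Z n ω ∈ B} * P {ω | (fun i => Z (n + i) ω) ∈ A} := by
  have key := indep_iSup_of_disjoint (S := Iio n) (T := Ici n) (μ := P)
    (fun i => (hZ_meas i).comap_le) hZ_indep (by
      rw [Set.disjoint_left]; intro x hx hx'; exact (not_lt.2 (mem_Ici.1 hx')) hx)
  rw [Indep_iff] at key
  refine key _ _ ?_ ?_
  · have : Measurable[⨆ i ∈ Iio n, MeasurableSpace.comap (Z i) inferInstance]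
        (partialSum Z n) := by
      unfold partialSum
      refine Finset.measurable_sum _ fun i hi => ?_
      exact (comap_measurable (Z i)).mono
        (le_iSup₂_of_le i (by simpa using hi) le_rfl) le_rfl
    exact this hB
  · have : Measurable[⨆ i ∈ Ici n, MeasurableSpace.comap (Z i) inferInstance]
        (fun ω i => Z (n + i) ω) := by
      refine @measurable_pi_lambda _ _ _ (_) _ _ fun i => ?_
      exact (comap_measurable (Z (n + i))).mono
        (le_iSup₂_of_le (n + i) (by simp) le_rfl) le_rfl
    exact this hA

/-- The event, in sequence space, that the walk stays above `h` from time `N` on. -/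
def escapeSet (h : ℝ) (N : ℕ) : Set (ℕ → ℝ) :=
  {z | ∀ m, N ≤ m → h < ∑ i ∈ Finset.range m, z i}

lemma measurableSet_escapeSet (h : ℝ) (N : ℕ) : MeasurableSet (escapeSet h N) := by
  have : escapeSet h N = ⋂ m, ⋂ (_ : N ≤ m), {z | h < ∑ i ∈ Finset.range m, z i} := by
    ext; simp [escapeSet]
  rw [this]
  refine MeasurableSet.iInter fun m => MeasurableSet.iInter fun _ => ?_
  exact measurableSet_lt measurable_const
    (Finset.measurable_sum _ fun i _ => measurable_pi_apply i)

lemma exists_half_le_measure_escapeSet [IsProbabilityMeasure P]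
    (hZ_indep : iIndepFun Z P) (hZ_ident : ∀ i, IdentDistrib (Z i) (Z 0) P P)
    (hZ_int : Integrable (Z 0) P) (hZ_pos : 0 < ∫ ω, Z 0 ω ∂P) (h : ℝ) :
    ∃ N, 1 / 2 ≤ P {ω | (fun i => Z i ω) ∈ escapeSet h N} := by
  have hmono : Monotone fun N => {ω | (fun i => Z i ω) ∈ escapeSet h N} := by
    intro N M hNM ω hω m hm
    exact hω m (hNM.trans hm)
  have hlim := tendsto_measure_iUnion_atTop (μ := P) hmono
  have hone : P (⋃ N, {ω | (fun i => Z i ω) ∈ escapeSet h N}) = 1 := by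
    rw [← measure_univ (μ := P)]
    refine measure_congr (eventuallyEq_univ.2 ?_)
    filter_upwards [ae_tendsto_partialSum_atTop hZ_indep hZ_ident hZ_int hZ_pos] with ω hT
    obtain ⟨N, hN⟩ := eventually_atTop.1 (hT.eventually_gt_atTop h)
    exact mem_iUnion.2 ⟨N, fun m hm => hN m hm⟩
  rw [hone] at hlim
  obtain ⟨N, hN⟩ := (hlim.eventually_const_lt (u := 1 / 2) (by simp)).exists
  exact ⟨N, hN.le⟩

/-- The renewal measure of intervals of a given length is bounded. After each of the times counted
by `H [a, a + h]` the walk has, with probability at least `1 / 2`, left the interval for good within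
`N` steps; and on any path this can happen after at most `N` of these times. -/
lemma exists_renewalMeasure_Icc_le [IsProbabilityMeasure P] (hZ_meas : ∀ i, Measurable (Z i))
    (hZ_indep : iIndepFun Z P) (hZ_ident : ∀ i, IdentDistrib (Z i) (Z 0) P P)
    (hZ_int : Integrable (Z 0) P) (hZ_pos : 0 < ∫ ω, Z 0 ω ∂P) (h : ℝ) :
    ∃ C : NNReal, ∀ a, renewalMeasure P Z (Icc a (a + h)) ≤ C := by
  obtain ⟨N, hN⟩ := exists_half_le_measure_escapeSet hZ_indep hZ_ident hZ_int hZ_pos h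
  refine ⟨2 * N, fun a => ?_⟩
  set I := Icc a (a + h)
  let A : ℕ → Set Ω := fun n =>
    {ω | partialSum Z n ω ∈ I} ∩ {ω | (fun i => Z (n + i) ω) ∈ escapeSet h N}
  have hA_meas : ∀ n, MeasurableSet (A n) := fun n =>
    (measurable_partialSum hZ_meas n measurableSet_Icc).inter
      (measurable_pi_iff.2 (fun i => hZ_meas (n + i)) (measurableSet_escapeSet h N))
  -- Two times of this kind are less than `N` apart, so all of them lie within `N` of the first.
  have hcount : ∀ ω, ∑' n, (A n).indicator (fun _ => (1 : ENNReal)) ω ≤ N := by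
    intro ω
    by_cases hex : ∃ n, ω ∈ A n
    · classical
      have h0 := Nat.find_spec hex
      set n₀ := Nat.find hex
      have hsupp : ∀ n, ω ∈ A n → n ∈ Finset.Ico n₀ (n₀ + N) := by
        intro n hn
        have hle : n₀ ≤ n := Nat.find_min' hex hn
        refine Finset.mem_Ico.2 ⟨hle, ?_⟩
        by_contra! hlt
        obtain ⟨m, rfl⟩ := Nat.exists_eq_add_of_le hle
        have h1 : h < partialSum (fun i => Z (n₀ + i)) m ω := h0.2 m (by omega)
        have h2 := partialSum_add Z n₀ m ω
        have h3 : a ≤ partialSum Z n₀ ω := h0.1.1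
        have h4 : partialSum Z (n₀ + m) ω ≤ a + h := hn.1.2
        linarith
      rw [tsum_eq_sum (s := Finset.Ico n₀ (n₀ + N))]
      · refine (Finset.sum_le_sum (g := fun _ => (1 : ENNReal)) fun n _ => ?_).trans (by simp)
        exact indicator_le_self' (by simp) ω
      · intro n hn
        exact indicator_of_notMem (fun hA => hn (hsupp n hA)) _
    · push Not at hex
      simp [hex]
  have hsum : ∑' n, P (A n) ≤ N := by
    calc ∑' n, P (A n) = ∫⁻ ω, ∑' n, (A n).indicator (fun _ => (1 : ENNReal)) ω ∂P := by
          rw [lintegral_tsum fun n => (measurable_const.indicator (hA_meas n)).aemeasurable]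
          congr 1; funext n
          rw [lintegral_indicator (hA_meas n)]; simp
      _ ≤ ∫⁻ _, (N : ENNReal) ∂P := lintegral_mono hcount
      _ = N := by simp
  have hle : ∀ n, P {ω | partialSum Z n ω ∈ I} ≤ 2 * P (A n) := by
    intro n
    have e : P (A n) = P {ω | partialSum Z n ω ∈ I} * P {ω | (fun i => Z i ω) ∈ escapeSet h N} := by
      rw [measure_inter_shift hZ_meas hZ_indep n measurableSet_Icc (measurableSet_escapeSet h N),
        measure_shift_eq hZ_meas hZ_indep hZ_ident n (measurableSet_escapeSet h N)]
    rw [e]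
    calc P {ω | partialSum Z n ω ∈ I} = 2 * (P {ω | partialSum Z n ω ∈ I} * (1 / 2)) := by
          rw [mul_comm 2, mul_assoc, one_div, ENNReal.inv_mul_cancel (by simp) (by simp), mul_one]
      _ ≤ _ := by gcongr
  rw [renewalMeasure, Measure.sum_apply _ measurableSet_Icc]
  calc ∑' n, P.map (partialSum Z n) I = ∑' n, P {ω | partialSum Z n ω ∈ I} := by
        congr 1; funext n
        rw [Measure.map_apply (measurable_partialSum hZ_meas n) measurableSet_Icc]; rfl
    _ ≤ ∑' n, 2 * P (A n) := ENNReal.tsum_le_tsum hle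
    _ = 2 * ∑' n, P (A n) := ENNReal.tsum_mul_left
    _ ≤ 2 * N := by gcongr
    _ = ((2 * N : NNReal) : ENNReal) := by simp

instance sFinite_renewalMeasure [SFinite P] : SFinite (renewalMeasure P Z) := by
  unfold renewalMeasure; infer_instance

end RandomWalk

/-! ### A telescoping identity for the renewal measure -/

section RenewalIdentity

variable {Ω : Type*} [MeasurableSpace Ω] {P : Measure Ω} {Z : ℕ → Ω → ℝ}

lemma integral_map_partialSum_succ [IsProbabilityMeasure P] (hZ_meas : ∀ i, Measurable (Z i))
    (hZ_indep : iIndepFun Z P) (hZ_ident : ∀ i, IdentDistrib (Z i) (Z 0) P P)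
    {G : ℝ → ℝ} (hG : Continuous G) {M : ℝ} (hM : ∀ s, |G s| ≤ M) (n : ℕ) :
    ∫ s, G s ∂(P.map (partialSum Z (n + 1))) =
      ∫ s, ∫ z, G (s + z) ∂(P.map (Z 0)) ∂(P.map (partialSum Z n)) := by
  have hS := measurable_partialSum hZ_meas
  have := Measure.isProbabilityMeasure_map (μ := P) (hS n).aemeasurable
  have := Measure.isProbabilityMeasure_map (μ := P) (hZ_meas 0).aemeasurable
  have hind : IndepFun (partialSum Z n) (Z n) P := by
    have h := hZ_indep.indepFun_sum_range_succ hZ_meas n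
    have e : partialSum Z n = ∑ j ∈ Finset.range n, Z j := by
      funext ω; simp [partialSum]
    rwa [e]
  have hprod := (indepFun_iff_map_prod_eq_prod_map_map (hS n).aemeasurable
    (hZ_meas n).aemeasurable).1 hind
  rw [(hZ_ident n).map_eq] at hprod
  have hint : Integrable (fun p : ℝ × ℝ => G (p.1 + p.2))
      ((P.map (partialSum Z n)).prod (P.map (Z 0))) :=
    Integrable.of_bound (by fun_prop) M (ae_of_all _ fun p => hM _)
  rw [← integral_prod _ hint, ← hprod, integral_map ((hS n).prodMk (hZ_meas n)).aemeasurable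
    (by fun_prop), integral_map (hS _).aemeasurable (by fun_prop)]
  simp [partialSum, Finset.sum_range_succ]

/-- The increments of `G s = ∫ t in s..x, g t` along the walk telescope to `G 0 = ∫ t in 0..x, g t`,
as the walk tends to infinity, and the mean of `G s - G (s + Z)` is the integral of
`z * g (s + v * z)` over the law of the step `z` and over `v` uniform in `(0, 1]`. -/
lemma intervalIntegral_eq_integral_renewalMeasure [IsProbabilityMeasure P]
    (hZ_meas : ∀ i, Measurable (Z i)) (hZ_indep : iIndepFun Z P)
    (hZ_ident : ∀ i, IdentDistrib (Z i) (Z 0) P P) (hZ_int : Integrable (Z 0) P)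
    (hZ_pos : 0 < ∫ ω, Z 0 ω ∂P) {g : ℝ → ℝ} (hg : Measurable g) (hg_int : Integrable g)
    {B : ℝ} (hB : ∀ t, |g t| ≤ B) {x : ℝ} (hgx : ∀ t, x < t → g t = 0)
    (hprod_int : Integrable (fun q : ℝ × (ℝ × ℝ) => q.2.1 * g (q.1 + q.2.1 * q.2.2))
      ((renewalMeasure P Z).prod ((P.map (Z 0)).prod (volume.restrict (Ioc (0 : ℝ) 1))))) :
    ∫ t in 0..x, g t =
      ∫ p, p.1 * (∫ s, g (s + p.1 * p.2) ∂(renewalMeasure P Z))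
        ∂((P.map (Z 0)).prod (volume.restrict (Ioc (0 : ℝ) 1))) := by
  have hS := measurable_partialSum hZ_meas
  have := fun n => Measure.isProbabilityMeasure_map (μ := P) (hS n).aemeasurable
  have := Measure.isProbabilityMeasure_map (μ := P) (hZ_meas 0).aemeasurable
  have hν : Integrable (fun z : ℝ => z) (P.map (Z 0)) :=
    (integrable_map_measure (by fun_prop) (hZ_meas 0).aemeasurable).2 hZ_int
  set ν := P.map (Z 0)
  let ρ := ν.prod (volume.restrict (Ioc (0 : ℝ) 1))
  let G : ℝ → ℝ := fun s => ∫ t in s..x, g t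
  have hii : ∀ a b, IntervalIntegrable g volume a b := fun a b => hg_int.intervalIntegrable
  have hG : Continuous G := by
    have : G = fun s => -∫ t in x..s, g t := by
      funext s; exact intervalIntegral.integral_symm _ _
    rw [this]
    exact (intervalIntegral.continuous_primitive hii x).neg
  have hGx : ∀ s, x ≤ s → G s = 0 := by
    intro s hs
    simp only [G]
    rw [intervalIntegral.integral_symm, intervalIntegral.integral_of_le hs,
      setIntegral_congr_fun measurableSet_Ioc (g := fun _ => (0 : ℝ)) fun t ht => hgx t ht.1]
    simp
  have hM : ∀ s, |G s| ≤ ∫ t, |g t| := by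
    intro s
    have h := intervalIntegral.norm_integral_le_integral_norm_uIoc (f := g) (μ := volume)
      (a := s) (b := x)
    exact h.trans (setIntegral_le_integral hg_int.norm (ae_of_all _ fun t => norm_nonneg _))
  set M := ∫ t, |g t|
  let W : ℝ → ℝ := fun s => ∫ p, p.1 * g (s + p.1 * p.2) ∂ρ
  have hW : ∀ s, W s = ∫ z, (G s - G (s + z)) ∂ν := by
    intro s
    have hint : Integrable (fun p : ℝ × ℝ => p.1 * g (s + p.1 * p.2)) ρ :=
      (hν.comp_fst _).mul_bdd (hg.comp (by fun_prop)).aestronglyMeasurable (ae_of_all _ fun p => hB _)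
    simp only [W, ρ]
    rw [integral_prod _ hint]
    congr 1; funext z
    -- The substitution `t = s + z * v`, valid also for `z = 0` in this form.
    have h1 := intervalIntegral.smul_integral_comp_add_mul (a := 0) (b := 1) g z s
    rw [mul_zero, add_zero, mul_one] at h1
    have h2 := intervalIntegral.integral_add_adjacent_intervals (hii s (s + z)) (hii (s + z) x)
    rw [integral_const_mul, ← intervalIntegral.integral_of_le zero_le_one]
    simp only [G, smul_eq_mul] at h1 ⊢
    linarith
  have hWint : Integrable W (renewalMeasure P Z) := hprod_int.integral_prod_left
  have hswap : ∫ s, W s ∂(renewalMeasure P Z) =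
      ∫ p, p.1 * (∫ s, g (s + p.1 * p.2) ∂(renewalMeasure P Z)) ∂ρ := by
    simp only [W]
    rw [integral_integral_swap hprod_int]
    congr 1; funext p
    exact integral_const_mul _ _
  have hsum : HasSum (fun n => ∫ s, W s ∂(P.map (partialSum Z n)))
      (∫ s, W s ∂(renewalMeasure P Z)) := hasSum_integral_measure hWint
  have hGint : ∀ n, Integrable G (P.map (partialSum Z n)) := fun n =>
    Integrable.of_bound (by fun_prop) M (ae_of_all _ fun s => hM s)
  have hstep : ∀ n, ∫ s, W s ∂(P.map (partialSum Z n)) =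
      ∫ s, G s ∂(P.map (partialSum Z n)) - ∫ s, G s ∂(P.map (partialSum Z (n + 1))) := by
    intro n
    rw [integral_map_partialSum_succ hZ_meas hZ_indep hZ_ident hG hM n]
    have hGz : ∀ s, Integrable (fun z => G (s + z)) ν := fun s =>
      Integrable.of_bound (by fun_prop) M (ae_of_all _ fun z => hM _)
    have hGG : Integrable (fun s => ∫ z, G (s + z) ∂ν) (P.map (partialSum Z n)) := by
      have : Integrable (fun p : ℝ × ℝ => G (p.1 + p.2)) ((P.map (partialSum Z n)).prod ν) :=
        Integrable.of_bound (by fun_prop) M (ae_of_all _ fun p => hM _)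
      exact this.integral_prod_left
    rw [← integral_sub (hGint n) hGG]
    congr 1; funext s
    rw [hW, integral_sub (integrable_const _) (hGz s)]
    simp
  have hlim : Tendsto (fun n => ∫ s, G s ∂(P.map (partialSum Z n))) atTop (𝓝 0) := by
    have h := tendsto_integral_of_dominated_convergence (μ := P)
      (F := fun n ω => G (partialSum Z n ω)) (f := fun _ => (0 : ℝ)) (fun _ => M)
      (fun n => (hG.measurable.comp (hS n)).aestronglyMeasurable) (integrable_const _)
      (fun n => ae_of_all _ fun ω => hM _) (by
        filter_upwards [ae_tendsto_partialSum_atTop hZ_indep hZ_ident hZ_int hZ_pos] with ω hω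
        refine tendsto_const_nhds.congr' ?_
        filter_upwards [hω.eventually_ge_atTop x] with n hn
        exact (hGx _ hn).symm)
    rw [integral_zero] at h
    refine h.congr fun n => ?_
    rw [integral_map (hS n).aemeasurable hG.aestronglyMeasurable]
  have hsum' := hsum.tendsto_sum_nat
  simp only [hstep] at hsum'
  simp only [Finset.sum_range_sub'] at hsum'
  have h0 : ∫ s, G s ∂(P.map (partialSum Z 0)) = ∫ t in 0..x, g t := by
    rw [integral_map (hS 0).aemeasurable hG.aestronglyMeasurable]
    simp [partialSum, G]
  rw [h0] at hsum'
  have h := tendsto_nhds_unique hsum' (tendsto_const_nhds.sub hlim)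
  rw [sub_zero] at h
  rw [← hswap, h]

end RenewalIdentity

/-! ### Slowly varying functions in additive notation -/

/-- Slow variation in additive notation: `f` is a positive function on `[0, ∞)`, extended by zero
to the negative reals, with `f (y + u) / f y → 1` as `y → ∞` for every `u`; it is of the form
`y ↦ L (exp y)` for a slowly varying function `L`. Local boundedness is part of the definition. -/
structure IsAddSlowlyVarying (f : ℝ → ℝ) : Prop where
  measurable : Measurable f
  eq_zero : ∀ y, y < 0 → f y = 0
  pos : ∀ y, 0 ≤ y → 0 < f y
  bdd : ∀ b, ∃ B, 0 ≤ B ∧ ∀ y ≤ b, f y ≤ B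
  tendsto_ratio : ∀ u, Tendsto (fun y => f (y + u) / f y) atTop (𝓝 1)

namespace IsAddSlowlyVarying

variable {f : ℝ → ℝ}

lemma nonneg (hf : IsAddSlowlyVarying f) (y : ℝ) : 0 ≤ f y := by
  rcases lt_or_ge y 0 with h | h
  · exact (hf.eq_zero y h).ge
  · exact (hf.pos y h).le

lemma integrableOn (hf : IsAddSlowlyVarying f) {s : Set ℝ} {b : ℝ} (hs : volume s ≠ ⊤)
    (hsb : ∀ y ∈ s, y ≤ b) (hsm : MeasurableSet s) : IntegrableOn f s := by
  obtain ⟨B, -, hB⟩ := hf.bdd b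
  have : IsFiniteMeasure (volume.restrict s) := ⟨by simpa using hs.lt_top⟩
  refine Integrable.of_bound hf.measurable.aestronglyMeasurable B ?_
  refine (ae_restrict_iff' hsm).2 (ae_of_all _ fun y hy => ?_)
  rw [Real.norm_of_nonneg (hf.nonneg y)]
  exact hB y (hsb y hy)

lemma intervalIntegrable (hf : IsAddSlowlyVarying f) (a b : ℝ) :
    IntervalIntegrable f volume a b := by
  rw [intervalIntegrable_iff]
  exact hf.integrableOn (b := max a b) (by simp [uIoc]) (fun y hy => hy.2) measurableSet_uIoc

lemma eventually_abs_sub_le (hf : IsAddSlowlyVarying f) (u : ℝ) {ε : ℝ} (hε : 0 < ε) :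
    ∀ᶠ y in atTop, |f (y + u) - f y| ≤ ε * f y := by
  filter_upwards [(hf.tendsto_ratio u).eventually (Metric.ball_mem_nhds 1 hε),
    eventually_ge_atTop 0] with y hy h0
  have hp := hf.pos y h0
  rw [Real.dist_eq] at hy
  have e : f (y + u) - f y = (f (y + u) / f y - 1) * f y := by field_simp
  rw [e, abs_mul, abs_of_pos hp]
  gcongr

/-- The part of `[0, 2]` on which `u ↦ f (y + u)` is not within a factor `2` of `f y`. -/
def badSet (f : ℝ → ℝ) (y : ℝ) : Set ℝ :=
  {u | u ∈ Icc 0 2 ∧ ¬ (f y ≤ 2 * f (y + u) ∧ f (y + u) ≤ 2 * f y)}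

lemma measurableSet_badSet (hf : IsAddSlowlyVarying f) (y : ℝ) : MeasurableSet (badSet f y) := by
  have h := hf.measurable
  have hu : Measurable fun u => f (y + u) := h.comp (by fun_prop)
  refine measurableSet_Icc.inter (MeasurableSet.compl ?_)
  exact (measurableSet_le measurable_const (hu.const_mul 2)).inter
    (measurableSet_le hu measurable_const)

lemma tendsto_volume_badSet (hf : IsAddSlowlyVarying f) :
    Tendsto (fun y => volume (badSet f y)) atTop (𝓝 0) := by
  have h := tendsto_measure_of_ae_tendsto_indicator (μ := volume) (A := ∅) atTop
    MeasurableSet.empty (As := badSet f) (fun y => hf.measurableSet_badSet y)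
    (measurableSet_Icc (a := (0 : ℝ)) (b := 2)) (by simp)
    (Eventually.of_forall fun y u hu => hu.1) (ae_of_all _ fun u => by
      filter_upwards [hf.eventually_abs_sub_le u (ε := 1 / 2) (by norm_num)] with y hy
      have := abs_le.1 hy
      have h0 := hf.nonneg y
      exact iff_of_false (fun hu => hu.2 ⟨by linarith, by linarith⟩) (notMem_empty u))
  simpa using h

/-- Over distances at most `1`, a slowly varying function eventually changes by at most a factor
`4`: for nearby `y` and `y'`, most points `t` shortly above both are good for both of them, so some
`t` has `f t` within a factor `2` of `f y` and of `f y'`. -/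
lemma exists_forall_le_four_mul (hf : IsAddSlowlyVarying f) :
    ∃ K, 0 ≤ K ∧ ∀ y y', K ≤ y → K ≤ y' → |y - y'| ≤ 1 → f y' ≤ 4 * f y := by
  obtain ⟨K, hK⟩ := eventually_atTop.1
    (hf.tendsto_volume_badSet.eventually_lt_const (u := 1 / 2) (by simp))
  have key : ∀ y d, K ≤ y → 0 ≤ d → d ≤ 1 → f (y + d) ≤ 4 * f y ∧ f y ≤ 4 * f (y + d) := by
    intro y d hy hd0 hd1
    have hex : ∃ u ∈ Icc (0 : ℝ) 1, u ∉ badSet f (y + d) ∧ u + d ∉ badSet f y := by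
      by_contra! hcon
      have hsub : Icc (0 : ℝ) 1 ⊆ badSet f (y + d) ∪ (fun u => u + d) ⁻¹' badSet f y := by
        intro u hu
        by_cases h : u ∈ badSet f (y + d)
        · exact Or.inl h
        · exact Or.inr (hcon u hu h)
      have h1 := (measure_mono (μ := volume) hsub).trans (measure_union_le _ _)
      rw [measure_preimage_add_right, Real.volume_Icc] at h1
      have h2 := ENNReal.add_lt_add (hK (y + d) (by linarith)) (hK y hy)
      rw [ENNReal.add_halves] at h2
      simp at h1
      exact absurd (h1.trans_lt h2) (lt_irrefl _)
    obtain ⟨u, hu, h1, h2⟩ := hex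
    have h1' : f (y + d) ≤ 2 * f (y + d + u) ∧ f (y + d + u) ≤ 2 * f (y + d) := by
      by_contra hc; exact h1 ⟨⟨hu.1, by linarith [hu.2]⟩, hc⟩
    have h2' : f y ≤ 2 * f (y + (u + d)) ∧ f (y + (u + d)) ≤ 2 * f y := by
      by_contra hc; exact h2 ⟨⟨by linarith [hu.1], by linarith [hu.2]⟩, hc⟩
    rw [show y + d + u = y + (u + d) by ring] at h1'
    constructor <;> linarith [h1'.1, h1'.2, h2'.1, h2'.2]
  refine ⟨max K 0, le_max_right _ _, fun y y' hy hy' hyy => ?_⟩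
  have h := abs_le.1 hyy
  rcases le_total y y' with hle | hle
  · have := (key y (y' - y) ((le_max_left _ _).trans hy) (by linarith) (by linarith)).1
    rwa [add_sub_cancel] at this
  · have := (key y' (y - y') ((le_max_left _ _).trans hy') (by linarith) (by linarith)).2
    rwa [add_sub_cancel] at this

lemma integral_mono_right (hf : IsAddSlowlyVarying f) {x y : ℝ} (hxy : x ≤ y) :
    ∫ t in 0..x, f t ≤ ∫ t in 0..y, f t := by
  have h := intervalIntegral.integral_add_adjacent_intervals (hf.intervalIntegrable 0 x)
    (hf.intervalIntegrable x y)
  have h2 := intervalIntegral.integral_nonneg (μ := volume) hxy fun t _ => hf.nonneg t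
  linarith

/-- Each `f (x - k)` is at most four times the integral of `f` over the unit interval that ends at
`x - k`. -/
lemma eventually_sum_le (hf : IsAddSlowlyVarying f) (N : ℕ) :
    ∀ᶠ x in atTop, ∑ k ∈ Finset.range N, f (x - k) ≤ 4 * ∫ t in 0..x, f t := by
  obtain ⟨K, hK0, hK⟩ := hf.exists_forall_le_four_mul
  induction N with
  | zero =>
    filter_upwards [eventually_ge_atTop 0] with x hx
    simpa using intervalIntegral.integral_nonneg (μ := volume) hx fun t _ => hf.nonneg t
  | succ N ih =>
    have ih' := (tendsto_atTop_add_const_right atTop (-1 : ℝ) tendsto_id).eventually ih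
    filter_upwards [ih', eventually_ge_atTop (K + 1)] with x hx hxK
    rw [Finset.sum_range_succ']
    have h1 : ∑ k ∈ Finset.range N, f (x - (k + 1 : ℕ)) = ∑ k ∈ Finset.range N, f (x + -1 - k) :=
      Finset.sum_congr rfl fun k _ => by congr 1; push_cast; ring
    have h2 := intervalIntegral.integral_add_adjacent_intervals (hf.intervalIntegrable 0 (x + -1))
      (hf.intervalIntegrable (x + -1) x)
    have h3 : ∫ _ in (x + -1)..x, f x ≤ ∫ t in (x + -1)..x, 4 * f t := by
      refine intervalIntegral.integral_mono_on (by linarith) (by simp)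
        ((hf.intervalIntegrable _ _).const_mul 4) fun t ht => ?_
      refine hK t x (by linarith [ht.1]) (by linarith) (abs_le.2 ⟨?_, ?_⟩) <;>
        linarith [ht.1, ht.2]
    rw [intervalIntegral.integral_const, intervalIntegral.integral_const_mul, smul_eq_mul] at h3
    simp only [id] at hx
    rw [h1]
    simp only [Nat.cast_zero, sub_zero]
    linarith

/-- A slowly varying function is negligible compared to its primitive: the integral over
`[x - N, x]` alone is of order `N * f x`. -/
lemma eventually_le_mul_integral (hf : IsAddSlowlyVarying f) {ε : ℝ} (hε : 0 < ε) :
    ∀ᶠ x in atTop, f x ≤ ε * ∫ t in 0..x, f t := by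
  obtain ⟨N, hN⟩ := exists_nat_gt (8 / ε)
  have hall : ∀ᶠ x in atTop, ∀ k ∈ Finset.range N, f x / 2 ≤ f (x - k) := by
    rw [Filter.eventually_all_finset]
    intro k _
    filter_upwards [hf.eventually_abs_sub_le (-(k : ℝ)) (ε := 1 / 2) (by norm_num)] with x hx
    rw [← sub_eq_add_neg] at hx
    linarith [(abs_le.1 hx).1]
  filter_upwards [hall, hf.eventually_sum_le N] with x h1 h2
  have h3 := Finset.card_nsmul_le_sum _ _ _ h1
  rw [Finset.card_range, nsmul_eq_mul] at h3
  have h4 : 8 / ε * (f x / 2) ≤ N * (f x / 2) := by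
    have := hf.nonneg x
    gcongr
  have h5 : f x = ε / 4 * (8 / ε * (f x / 2)) := by field_simp; ring
  rw [h5]
  calc ε / 4 * (8 / ε * (f x / 2)) ≤ ε / 4 * (4 * ∫ t in 0..x, f t) := 
        mul_le_mul_of_nonneg_left (by linarith) (by positivity)
    _ = _ := by ring

end IsAddSlowlyVarying

/-! ### Integrals of slowly varying functions against measures bounded on unit intervals -/

/-- The function `t ↦ f (x - t)` cut off at the left of the origin; together with `f = 0` on the
negative reals it is supported in `(0, x]`. -/
noncomputable def reflectCut (f : ℝ → ℝ) (x : ℝ) : ℝ → ℝ := (Ioi 0).indicator fun t => f (x - t)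

namespace IsAddSlowlyVarying

variable {f : ℝ → ℝ}

lemma measurable_reflectCut (hf : IsAddSlowlyVarying f) (x : ℝ) : Measurable (reflectCut f x) :=
  (hf.measurable.comp (by fun_prop)).indicator measurableSet_Ioi

lemma reflectCut_nonneg (hf : IsAddSlowlyVarying f) (x t : ℝ) : 0 ≤ reflectCut f x t :=
  indicator_nonneg (fun _ _ => hf.nonneg _) t

lemma reflectCut_eq_zero (hf : IsAddSlowlyVarying f) {x t : ℝ} (h : x < t) :
    reflectCut f x t = 0 := by
  rw [reflectCut, indicator_apply_eq_zero]
  exact fun _ => hf.eq_zero _ (by linarith)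

lemma integral_reflectCut (f : ℝ → ℝ) {x : ℝ} (hx : 0 ≤ x) :
    ∫ t in 0..x, reflectCut f x t = ∫ t in 0..x, f t := by
  have h := intervalIntegral.integral_comp_sub_left (a := 0) (b := x) f x
  rw [sub_self, sub_zero] at h
  rw [← h, intervalIntegral.integral_of_le hx, intervalIntegral.integral_of_le hx]
  exact setIntegral_congr_fun measurableSet_Ioc fun t ht =>
    indicator_of_mem (show t ∈ Ioi (0 : ℝ) from ht.1) _

lemma integrable_reflectCut (hf : IsAddSlowlyVarying f) (x : ℝ) : Integrable (reflectCut f x) := by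
  obtain ⟨B, hB0, hB⟩ := hf.bdd x
  have h : IntegrableOn (reflectCut f x) (Ioc 0 x) := by
    refine Integrable.of_bound (hf.measurable_reflectCut x).aestronglyMeasurable B ?_
    refine (ae_restrict_iff' measurableSet_Ioc).2 (ae_of_all _ fun y hy => ?_)
    rw [Real.norm_of_nonneg (hf.reflectCut_nonneg x y), reflectCut,
      indicator_of_mem (show y ∈ Ioi (0 : ℝ) from hy.1)]
    exact hB _ (by linarith [hy.1])
  refine (integrableOn_iff_integrable_of_support_subset fun t ht => ?_).1 h
  by_contra hc
  rcases not_and_or.1 hc with h | h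
  · exact ht (indicator_of_notMem h _)
  · exact ht (hf.reflectCut_eq_zero (not_le.1 h))

/-- The integral of a shifted `reflectCut f x` against a measure for which intervals of bounded
length have bounded mass is at most of the order of `∫ t in 0..x, f t`, uniformly in the shift. -/
lemma exists_lintegral_reflectCut_le (hf : IsAddSlowlyVarying f) {H : Measure ℝ} [SFinite H]
    (hH : ∀ h : ℝ, ∃ C : NNReal, ∀ a, H (Icc a (a + h)) ≤ C) :
    ∃ A D : ℝ, 0 ≤ A ∧ 0 ≤ D ∧ ∀ x, 0 ≤ x → ∀ w,
      ∫⁻ s, ENNReal.ofReal (reflectCut f x (s + w)) ∂H ≤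
        ENNReal.ofReal (A + D * ∫ t in 0..x, f t) := by
  obtain ⟨K, hK0, hK⟩ := hf.exists_forall_le_four_mul
  obtain ⟨B, hB0, hB⟩ := hf.bdd (K + 1)
  obtain ⟨C₁, hC₁⟩ := hH (K + 1)
  obtain ⟨C₂, hC₂⟩ := hH 1
  refine ⟨B * C₁, 4 * C₂, by positivity, by positivity, fun x hx w => ?_⟩
  let φ : ℝ → ℝ → ENNReal := fun s t =>
    (Icc (x - w - t - 1) (x - w - t - 1 + 1)).indicator (fun _ => ENNReal.ofReal (f t)) s
  have hφ : Measurable (Function.uncurry φ) := by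
    have : Function.uncurry φ =
        {p : ℝ × ℝ | x - w - p.2 - 1 ≤ p.1 ∧ p.1 ≤ x - w - p.2 - 1 + 1}.indicator
          (fun p => ENNReal.ofReal (f p.2)) := by
      funext ⟨s, t⟩
      simp only [Function.uncurry, φ, indicator]
      rfl
    rw [this]
    refine Measurable.indicator (hf.measurable.comp measurable_snd).ennreal_ofReal ?_
    have hl : Measurable fun p : ℝ × ℝ => x - w - p.2 - 1 := by fun_prop
    exact (measurableSet_le hl measurable_fst).inter
      (measurableSet_le measurable_fst (hl.add_const 1))
  -- Far from the right end of the support the integrand is compared with its average over a unit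
  -- interval, near it `f` is bounded.
  have hpt : ∀ s, ENNReal.ofReal (reflectCut f x (s + w)) ≤
      (Icc (x - w - (K + 1)) (x - w - (K + 1) + (K + 1))).indicator
        (fun _ => ENNReal.ofReal B) s + 4 * ∫⁻ t in Icc 0 x, φ s t := by
    intro s
    by_cases h0 : 0 < s + w
    swap
    · rw [reflectCut, indicator_of_notMem (by simpa using h0)]; simp
    rw [reflectCut, indicator_of_mem (show s + w ∈ Ioi (0 : ℝ) from h0)]
    rcases lt_or_ge (x - (s + w)) 0 with hy | hy
    · rw [hf.eq_zero _ hy]; simp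
    rcases le_or_gt (x - (s + w)) (K + 1) with hy1 | hy1
    · refine le_add_right ?_
      rw [indicator_of_mem (by constructor <;> linarith)]
      exact ENNReal.ofReal_le_ofReal (hB _ hy1)
    · refine le_add_left ?_
      set y := x - (s + w) with hydef
      have hs : s = x - w - y := by rw [hydef]; ring
      calc ENNReal.ofReal (f y) = ∫⁻ _ in Icc (y - 1) y, ENNReal.ofReal (f y) := by simp
        _ ≤ ∫⁻ t in Icc (y - 1) y, 4 * φ s t := by
          refine setLIntegral_mono' measurableSet_Icc fun t ht => ?_
          simp only [φ]
          rw [indicator_of_mem (by constructor <;> linarith [ht.1, ht.2])]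
          rw [show (4 : ENNReal) = ENNReal.ofReal 4 by simp, ← ENNReal.ofReal_mul (by norm_num)]
          refine ENNReal.ofReal_le_ofReal (hK t y (by linarith [ht.1]) (by linarith) ?_)
          refine abs_le.2 ⟨?_, ?_⟩ <;> linarith [ht.1, ht.2]
        _ ≤ ∫⁻ t in Icc 0 x, 4 * φ s t :=
          lintegral_mono_set (Icc_subset_Icc (by linarith) (by linarith))
        _ = 4 * ∫⁻ t in Icc 0 x, φ s t :=
          lintegral_const_mul' _ _ (by simp)
  have hF : ∫⁻ t in Icc 0 x, ENNReal.ofReal (f t) = ENNReal.ofReal (∫ t in 0..x, f t) := by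
    rw [intervalIntegral.integral_of_le hx, ← integral_Icc_eq_integral_Ioc]
    exact (ofReal_integral_eq_lintegral_ofReal
      (hf.integrableOn (by simp) (fun y hy => hy.2) measurableSet_Icc)
      (ae_of_all _ fun t => hf.nonneg t)).symm
  have hF0 : 0 ≤ ∫ t in 0..x, f t :=
    intervalIntegral.integral_nonneg hx fun t _ => hf.nonneg t
  calc ∫⁻ s, ENNReal.ofReal (reflectCut f x (s + w)) ∂H
      ≤ ∫⁻ s, ((Icc (x - w - (K + 1)) (x - w - (K + 1) + (K + 1))).indicator
        (fun _ => ENNReal.ofReal B) s + 4 * ∫⁻ t in Icc 0 x, φ s t) ∂H := lintegral_mono hpt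
    _ = ENNReal.ofReal B * H (Icc (x - w - (K + 1)) (x - w - (K + 1) + (K + 1))) +
        4 * ∫⁻ s, (∫⁻ t in Icc 0 x, φ s t) ∂H := by
      rw [lintegral_add_left (measurable_const.indicator measurableSet_Icc),
        lintegral_indicator_const measurableSet_Icc, lintegral_const_mul' _ _ (by simp)]
    _ = ENNReal.ofReal B * H (Icc (x - w - (K + 1)) (x - w - (K + 1) + (K + 1))) +
        4 * ∫⁻ t in Icc 0 x, ENNReal.ofReal (f t) *
          H (Icc (x - w - t - 1) (x - w - t - 1 + 1)) := by
      rw [lintegral_lintegral_swap hφ.aemeasurable]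
      simp only [φ, lintegral_indicator_const measurableSet_Icc]
    _ ≤ ENNReal.ofReal B * C₁ + 4 * ∫⁻ t in Icc 0 x, ENNReal.ofReal (f t) * C₂ := by
      gcongr with t
      · exact hC₁ _
      · exact hC₂ _
    _ = ENNReal.ofReal (B * C₁ + 4 * C₂ * ∫ t in 0..x, f t) := by
      rw [lintegral_mul_const _ hf.measurable.ennreal_ofReal, hF,
        ENNReal.ofReal_add (by positivity) (by positivity), ENNReal.ofReal_mul hB0,
        ENNReal.ofReal_mul (by positivity), ENNReal.ofReal_mul (by norm_num)]
      simp only [ENNReal.ofReal_coe_nnreal, ENNReal.ofReal_ofNat]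
      ring

lemma integrable_reflectCut_add (hf : IsAddSlowlyVarying f) {H : Measure ℝ} [SFinite H]
    (hH : ∀ h : ℝ, ∃ C : NNReal, ∀ a, H (Icc a (a + h)) ≤ C) {x : ℝ} (hx : 0 ≤ x) (w : ℝ) :
    Integrable (fun s => reflectCut f x (s + w)) H := by
  obtain ⟨A, D, -, -, h⟩ := hf.exists_lintegral_reflectCut_le hH
  refine ⟨((hf.measurable_reflectCut x).comp (by fun_prop)).aestronglyMeasurable, ?_⟩
  rw [hasFiniteIntegral_iff_ofReal (ae_of_all _ fun s => hf.reflectCut_nonneg x _)]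
  exact (h x hx w).trans_lt ENNReal.ofReal_lt_top

lemma exists_integral_reflectCut_le (hf : IsAddSlowlyVarying f) {H : Measure ℝ} [SFinite H]
    (hH : ∀ h : ℝ, ∃ C : NNReal, ∀ a, H (Icc a (a + h)) ≤ C) :
    ∃ A D : ℝ, 0 ≤ A ∧ 0 ≤ D ∧ ∀ x, 0 ≤ x → ∀ w,
      ∫ s, reflectCut f x (s + w) ∂H ≤ A + D * ∫ t in 0..x, f t := by
  obtain ⟨A, D, hA, hD, h⟩ := hf.exists_lintegral_reflectCut_le hH
  refine ⟨A, D, hA, hD, fun x hx w => ?_⟩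
  have hF0 : 0 ≤ ∫ t in 0..x, f t :=
    intervalIntegral.integral_nonneg hx fun t _ => hf.nonneg t
  rw [integral_eq_lintegral_of_nonneg_ae (ae_of_all _ fun s => hf.reflectCut_nonneg x _)
    (hf.integrable_reflectCut_add hH hx w).aestronglyMeasurable]
  exact ENNReal.toReal_le_of_le_ofReal (by positivity) (h x hx w)

/-- Shifting the measure by a fixed amount changes the integral of `reflectCut f x` by a negligible
amount: the integrand changes by a small factor except near the two ends of `[0, x]`, where `f` is
`o(∫ t in 0..x, f t)` and bounded, respectively. -/
lemma isLittleO_integral_reflectCut_sub (hf : IsAddSlowlyVarying f) {H : Measure ℝ} [SFinite H]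
    (hH : ∀ h : ℝ, ∃ C : NNReal, ∀ a, H (Icc a (a + h)) ≤ C)
    (hF : Tendsto (fun x => ∫ t in 0..x, f t) atTop atTop) (w : ℝ) :
    (fun x => ∫ s, reflectCut f x (s + w) ∂H - ∫ s, reflectCut f x s ∂H)
      =o[atTop] fun x => ∫ t in 0..x, f t := by
  obtain ⟨A, D, hA, hD, hAD⟩ := hf.exists_integral_reflectCut_le hH
  obtain ⟨C₁, hC₁⟩ := hH (2 * |w|)
  have hw0 := abs_nonneg w
  rw [isLittleO_iff]
  intro c hc
  -- The four summands come from the bulk of `[0, x]` (`A` and `D`), from `s` near `0` (`C₁`), and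
  -- from `s` near `x` (`1`).
  obtain ⟨ε, hε0, hε⟩ : ∃ ε > 0, ε * (A + D + C₁ + 1) = c :=
    ⟨c / (A + D + C₁ + 1), by positivity, by field_simp⟩
  obtain ⟨K₀, hK₀⟩ := eventually_atTop.1 (hf.eventually_abs_sub_le (-w) hε0)
  obtain ⟨K, hKK₀, hKw⟩ : ∃ K, K₀ ≤ K ∧ |w| ≤ K := ⟨_, le_max_left _ _, le_max_right _ _⟩
  obtain ⟨B, hB0, hB⟩ := hf.bdd (K + |w|)
  obtain ⟨C₂, hC₂⟩ := hH (K + |w|)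
  obtain ⟨Y, hY⟩ := eventually_atTop.1 (hf.eventually_le_mul_integral hε0)
  filter_upwards [eventually_ge_atTop 0, eventually_ge_atTop (Y + 2 * |w|),
    hF.eventually_ge_atTop 1, hF.eventually_ge_atTop (B * C₂ / ε)] with x hx0 hxY hF1 hFB
  set F := ∫ t in 0..x, f t
  have hF0 : 0 ≤ F := zero_le_one.trans hF1
  let I₁ := Icc (-|w|) (-|w| + 2 * |w|)
  let I₂ := Icc (x - K) (x - K + (K + |w|))
  have hpt : ∀ s, ‖reflectCut f x (s + w) - reflectCut f x s‖ ≤ ε * reflectCut f x s +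
      (I₁.indicator (fun _ => ε * F) s + I₂.indicator (fun _ => B) s) := by
    intro s
    have ha := hf.reflectCut_nonneg x s
    have hb := hf.reflectCut_nonneg x (s + w)
    have hi1 : 0 ≤ I₁.indicator (fun _ => ε * F) s :=
      indicator_nonneg (fun _ _ => by positivity) s
    have hi2 : 0 ≤ I₂.indicator (fun _ => B) s := indicator_nonneg (fun _ _ => hB0) s
    have hea : 0 ≤ ε * reflectCut f x s := by positivity
    -- Two nonnegative numbers differ by at most a common upper bound.
    have hmax : ∀ M, reflectCut f x (s + w) ≤ M → reflectCut f x s ≤ M →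
        ‖reflectCut f x (s + w) - reflectCut f x s‖ ≤ M := fun M h1 h2 =>
      abs_le.2 ⟨by linarith, by linarith⟩
    have hww := neg_abs_le w
    have hww' := le_abs_self w
    by_cases h1 : s ∈ I₁
    · have hbd : ∀ t, t ≤ 2 * |w| → reflectCut f x t ≤ ε * F := by
        intro t ht
        by_cases ht0 : 0 < t
        · rw [reflectCut, indicator_of_mem (show t ∈ Ioi (0 : ℝ) from ht0)]
          refine (hY _ (by linarith)).trans ?_
          exact mul_le_mul_of_nonneg_left (hf.integral_mono_right (by linarith)) hε0.le
        · rw [reflectCut, indicator_of_notMem (by simpa using ht0)]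
          positivity
      have h := hmax (ε * F) (hbd _ (by linarith [h1.2])) (hbd _ (by linarith [h1.2]))
      rw [indicator_of_mem h1]
      linarith
    by_cases h2 : s ∈ I₂
    · have hbd : ∀ t, x - K - |w| ≤ t → reflectCut f x t ≤ B := by
        intro t ht
        by_cases ht0 : 0 < t
        · rw [reflectCut, indicator_of_mem (show t ∈ Ioi (0 : ℝ) from ht0)]
          exact hB _ (by linarith)
        · rw [reflectCut, indicator_of_notMem (by simpa using ht0)]
          exact hB0
      have h := hmax B (hbd _ (by linarith [h2.1])) (hbd _ (by linarith [h2.1]))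
      rw [indicator_of_mem h2]
      linarith
    refine le_trans ?_ (le_add_of_nonneg_right (add_nonneg hi1 hi2))
    -- Left of `I₁` and right of `I₂` both terms vanish; between the two, slow variation applies.
    rcases lt_or_ge s (-|w|) with h3 | h3
    · have e1 : reflectCut f x s = 0 := indicator_of_notMem (by simp; linarith) _
      have e2 : reflectCut f x (s + w) = 0 := indicator_of_notMem (by simp; linarith) _
      simp [e1, e2]
    have h4 : |w| < s := by
      by_contra! hc
      exact h1 ⟨h3, by linarith⟩
    rcases lt_or_ge s (x - K) with h5 | h5
    · rw [reflectCut, indicator_of_mem (show s ∈ Ioi (0 : ℝ) from by simp; linarith),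
        indicator_of_mem (show s + w ∈ Ioi (0 : ℝ) from by simp; linarith)]
      have := hK₀ (x - s) (by linarith)
      rwa [show x - s + -w = x - (s + w) by ring] at this
    · have h6 : x + |w| < s := by
        by_contra! hc
        exact h2 ⟨h5, by linarith⟩
      rw [hf.reflectCut_eq_zero (show x < s by linarith),
        hf.reflectCut_eq_zero (show x < s + w by linarith)]
      simp
  have hint0 : Integrable (reflectCut f x) H := by
    simpa using hf.integrable_reflectCut_add hH hx0 0
  have hI₁ : H I₁ ≤ C₁ := hC₁ _
  have hI₂ : H I₂ ≤ C₂ := hC₂ _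
  have hi1 : Integrable (I₁.indicator fun _ => ε * F) H :=
    (integrable_indicator_iff measurableSet_Icc).2
      (integrableOn_const (hI₁.trans_lt ENNReal.coe_lt_top).ne)
  have hi2 : Integrable (I₂.indicator fun _ => B) H :=
    (integrable_indicator_iff measurableSet_Icc).2
      (integrableOn_const (hI₂.trans_lt ENNReal.coe_lt_top).ne)
  have hbound := norm_integral_le_of_norm_le ((hint0.const_mul ε).add (hi1.add hi2))
    (ae_of_all _ hpt)
  rw [← integral_sub (hf.integrable_reflectCut_add hH hx0 w) hint0]
  refine hbound.trans ?_
  rw [integral_add' (hint0.const_mul ε) (hi1.add hi2), integral_add' hi1 hi2, integral_const_mul,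
    integral_indicator_const _ measurableSet_Icc, integral_indicator_const _ measurableSet_Icc,
    smul_eq_mul, smul_eq_mul, Real.norm_of_nonneg hF0]
  have hr1 : H.real I₁ ≤ C₁ := ENNReal.toReal_mono ENNReal.coe_ne_top hI₁
  have hr2 : H.real I₂ ≤ C₂ := ENNReal.toReal_mono ENNReal.coe_ne_top hI₂
  have hJ : ∫ s, reflectCut f x s ∂H ≤ (A + D) * F := by
    have h := hAD x hx0 0
    simp only [add_zero] at h
    have : A ≤ A * F := le_mul_of_one_le_right hA hF1
    linarith
  have hBF : B * C₂ ≤ ε * F := by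
    rw [div_le_iff₀ hε0] at hFB
    linarith
  calc ε * ∫ s, reflectCut f x s ∂H + (H.real I₁ * (ε * F) + H.real I₂ * B)
      ≤ ε * ((A + D) * F) + (C₁ * (ε * F) + C₂ * B) := by gcongr
    _ ≤ ε * (A + D + C₁ + 1) * F := by linarith
    _ = c * F := by rw [hε]

end IsAddSlowlyVarying

/-! ### Asymptotics of the renewal integral -/

section RenewalTheorem

variable {Ω : Type*} [MeasurableSpace Ω] {P : Measure Ω} {Z : ℕ → Ω → ℝ}

/-- A key renewal theorem for a slowly varying integrand with divergent integral, in additive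
notation. -/
lemma IsAddSlowlyVarying.tendsto_integral_renewalMeasure_div [IsProbabilityMeasure P]
    (hZ_meas : ∀ i, Measurable (Z i)) (hZ_indep : iIndepFun Z P)
    (hZ_ident : ∀ i, IdentDistrib (Z i) (Z 0) P P) (hZ_int : Integrable (Z 0) P)
    (hZ_pos : 0 < ∫ ω, Z 0 ω ∂P) {f : ℝ → ℝ} (hf : IsAddSlowlyVarying f)
    (hF : Tendsto (fun x => ∫ t in 0..x, f t) atTop atTop) :
    Tendsto (fun x => (∫ s, reflectCut f x s ∂(renewalMeasure P Z)) / ∫ t in 0..x, f t) atTop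
      (𝓝 (∫ ω, Z 0 ω ∂P)⁻¹) := by
  have hH := exists_renewalMeasure_Icc_le hZ_meas hZ_indep hZ_ident hZ_int hZ_pos
  obtain ⟨A, D, hA, hD, hAD⟩ := hf.exists_integral_reflectCut_le hH
  have hlittle := hf.isLittleO_integral_reflectCut_sub hH hF
  have := Measure.isProbabilityMeasure_map (μ := P) (hZ_meas 0).aemeasurable
  have hν : Integrable (fun z : ℝ => z) (P.map (Z 0)) :=
    (integrable_map_measure (by fun_prop) (hZ_meas 0).aemeasurable).2 hZ_int
  have hmean : ∫ z, z ∂(P.map (Z 0)) = ∫ ω, Z 0 ω ∂P :=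
    integral_map (hZ_meas 0).aemeasurable (by fun_prop)
  set H := renewalMeasure P Z
  set ρ := (P.map (Z 0)).prod (volume.restrict (Ioc (0 : ℝ) 1)) with hρ
  have : IsProbabilityMeasure (volume.restrict (Ioc (0 : ℝ) 1)) := ⟨by simp⟩
  have hfst : Integrable (fun p : ℝ × ℝ => p.1) ρ := hν.comp_fst _
  have hfst_mean : ∫ p, p.1 ∂ρ = ∫ ω, Z 0 ω ∂P := by
    rw [← hmean, hρ, integral_prod _ hfst]
    simp
  set F : ℝ → ℝ := fun x => ∫ t in 0..x, f t with hFdef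
  let J : ℝ → ℝ → ℝ := fun x w => ∫ s, reflectCut f x (s + w) ∂H
  have hJ0 : ∀ x w, 0 ≤ J x w := fun x w => integral_nonneg fun s => hf.reflectCut_nonneg x _
  have hJ_meas : ∀ x, Measurable fun p : ℝ × ℝ => J x (p.1 * p.2) := by
    intro x
    have h : StronglyMeasurable fun q : ℝ × (ℝ × ℝ) => reflectCut f x (q.1 + q.2.1 * q.2.2) :=
      ((hf.measurable_reflectCut x).comp (by fun_prop)).stronglyMeasurable
    exact (h.integral_prod_left' (μ := H)).measurable
  have hJ_int : ∀ x, 0 ≤ x → Integrable (fun p : ℝ × ℝ => p.1 * J x (p.1 * p.2)) ρ := by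
    intro x hx
    refine hfst.mul_bdd (c := A + D * F x) (hJ_meas x).aestronglyMeasurable
      (ae_of_all _ fun p => ?_)
    rw [Real.norm_of_nonneg (hJ0 _ _)]
    exact hAD x hx _
  have hident : ∀ x, 0 ≤ x → F x = ∫ p, p.1 * J x (p.1 * p.2) ∂ρ := by
    intro x hx
    obtain ⟨B, hB0, hB⟩ := hf.bdd x
    have hbd : ∀ t, |reflectCut f x t| ≤ B := by
      intro t
      rw [abs_of_nonneg (hf.reflectCut_nonneg x t)]
      by_cases ht0 : 0 < t
      · rw [reflectCut, indicator_of_mem (show t ∈ Ioi (0 : ℝ) from ht0)]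
        exact hB _ (by linarith)
      · rw [reflectCut, indicator_of_notMem (by simpa using ht0)]
        exact hB0
    simp only [hFdef]
    rw [← IsAddSlowlyVarying.integral_reflectCut f hx]
    refine intervalIntegral_eq_integral_renewalMeasure hZ_meas hZ_indep hZ_ident hZ_int hZ_pos
      (hf.measurable_reflectCut x) (hf.integrable_reflectCut x) hbd
      (fun t ht => hf.reflectCut_eq_zero ht) ?_
    have hm : Measurable fun q : ℝ × (ℝ × ℝ) => q.2.1 * reflectCut f x (q.1 + q.2.1 * q.2.2) :=
      (by fun_prop : Measurable fun q : ℝ × (ℝ × ℝ) => q.2.1).mul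
        ((hf.measurable_reflectCut x).comp (by fun_prop))
    refine (integrable_prod_iff' hm.aestronglyMeasurable).2 ⟨ae_of_all _ fun p => ?_, ?_⟩
    · exact (hf.integrable_reflectCut_add hH hx (p.1 * p.2)).const_mul p.1
    · refine (hJ_int x hx).norm.congr (ae_of_all _ fun p => ?_)
      simp only [norm_mul]
      rw [integral_const_mul, Real.norm_of_nonneg (hJ0 x _)]
      congr 1
      exact integral_congr_ae (ae_of_all _ fun s =>
        (Real.norm_of_nonneg (hf.reflectCut_nonneg x _)).symm)
  have hdct : Tendsto (fun x => ∫ p, p.1 * ((J x (p.1 * p.2) - J x 0) / F x) ∂ρ) atTop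
      (𝓝 (∫ _, 0 ∂ρ)) := by
    refine tendsto_integral_filter_of_dominated_convergence (fun p => |p.1| * (2 * (A + D)))
      (Eventually.of_forall fun x => ?_) ?_ (hfst.abs.mul_const _) (ae_of_all _ fun p => ?_)
    · exact (measurable_fst.mul (((hJ_meas x).sub_const _).div_const _)).aestronglyMeasurable
    · filter_upwards [eventually_ge_atTop 0, hF.eventually_ge_atTop 1] with x hx hF1
      refine ae_of_all _ fun p => ?_
      have hF1' : 1 ≤ F x := hF1
      have hF0 : 0 < F x := zero_lt_one.trans_le hF1'
      rw [norm_mul, norm_div, Real.norm_eq_abs, Real.norm_eq_abs, Real.norm_of_nonneg hF0.le]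
      refine mul_le_mul_of_nonneg_left ?_ (abs_nonneg _)
      rw [div_le_iff₀ hF0]
      have h1 : J x (p.1 * p.2) ≤ A + D * F x := hAD x hx _
      have h2 : J x 0 ≤ A + D * F x := hAD x hx _
      have h3 := hJ0 x (p.1 * p.2)
      have h4 := hJ0 x 0
      have h5 : A ≤ A * F x := le_mul_of_one_le_right hA hF1'
      exact abs_le.2 ⟨by linarith, by linarith⟩
    · have h := ((hlittle (p.1 * p.2)).tendsto_div_nhds_zero).const_mul p.1
      simpa only [J, add_zero, mul_zero] using h
  rw [integral_zero] at hdct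
  set m := ∫ ω, Z 0 ω ∂P
  have hlim : Tendsto (fun x => 1 - m * (J x 0 / F x)) atTop (𝓝 0) := by
    refine hdct.congr' ?_
    filter_upwards [eventually_ge_atTop 0, hF.eventually_ge_atTop 1] with x hx hF1
    have hF0 : F x ≠ 0 := (zero_lt_one.trans_le hF1).ne'
    calc ∫ p, p.1 * ((J x (p.1 * p.2) - J x 0) / F x) ∂ρ
        = ∫ p, (p.1 * J x (p.1 * p.2) / F x - p.1 * (J x 0 / F x)) ∂ρ := by
          congr 1; funext p; ring
      _ = F x / F x - m * (J x 0 / F x) := by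
          rw [integral_sub ((hJ_int x hx).div_const _) (hfst.mul_const _), integral_div,
            integral_mul_const, hfst_mean, ← hident x hx]
      _ = 1 - m * (J x 0 / F x) := by rw [div_self hF0]
  have hlim2 := (hlim.const_sub 1).const_mul m⁻¹
  simp only [sub_sub_cancel, sub_zero, mul_one] at hlim2
  refine hlim2.congr fun x => ?_
  rw [inv_mul_cancel_left₀ hZ_pos.ne']
  simp only [J, add_zero, hFdef]

end RenewalTheorem

section Exponential

variable {L : ℝ → ℝ}

lemma IsSlowlyVarying.isAddSlowlyVarying (hL : IsSlowlyVarying L)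
    (hL_bdd : ∀ b : ℝ, BddAbove (L '' Icc 1 b)) :
    IsAddSlowlyVarying ((Ici 0).indicator fun y => L (Real.exp y)) where
  measurable := by
    refine Measurable.indicator ?_ measurableSet_Ici
    have he : Measurable fun y : ℝ => (⟨Real.exp y, Real.exp_pos y⟩ : Ioi (0 : ℝ)) :=
      Real.measurable_exp.subtype_mk
    exact hL.measurable_restrict.comp he
  eq_zero y hy := indicator_of_notMem (by simpa using hy) _
  pos y hy := by
    rw [indicator_of_mem (mem_Ici.2 hy)]
    exact hL.pos _ (Real.exp_pos y)
  bdd b := by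
    obtain ⟨B, hB⟩ := hL_bdd (Real.exp b)
    refine ⟨max B 0, le_max_right _ _, fun y hy => ?_⟩
    by_cases h : 0 ≤ y
    · rw [indicator_of_mem (mem_Ici.2 h)]
      exact (hB ⟨_, ⟨Real.one_le_exp h, Real.exp_le_exp.2 hy⟩, rfl⟩).trans (le_max_left _ _)
    · rw [indicator_of_notMem (by simpa using h)]
      exact le_max_right _ _
  tendsto_ratio u := by
    have h := (hL.tendsto_ratio (Real.exp u) (Real.exp_pos u)).comp Real.tendsto_exp_atTop
    rw [Real.rpow_zero] at h
    refine h.congr' ?_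
    filter_upwards [eventually_ge_atTop 0, eventually_ge_atTop (-u)] with y h0 hu
    rw [indicator_of_mem (mem_Ici.2 h0), indicator_of_mem (mem_Ici.2 (by linarith))]
    simp [Real.exp_add, mul_comm]

/-- The substitution `t = exp y` in the de Haan integral. -/
lemma integral_comp_exp_eq_deHaan_sub
    (hL_fin : ∀ x : ℝ, 0 < x → IntegrableOn (fun t : ℝ => L t / t) (Ioc 0 x)) {x : ℝ}
    (hx : 0 ≤ x) :
    ∫ y in 0..x, (Ici 0).indicator (fun y => L (Real.exp y)) y =
      deHaan L (Real.exp x) - deHaan L 1 := by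
  have hex := Real.one_le_exp hx
  have himg : Real.exp '' Ioc 0 x = Ioc 1 (Real.exp x) := by
    ext t
    constructor
    · rintro ⟨y, hy, rfl⟩
      exact ⟨Real.one_lt_exp_iff.2 hy.1, Real.exp_le_exp.2 hy.2⟩
    · rintro ⟨h1, h2⟩
      have ht : 0 < t := zero_lt_one.trans h1
      exact ⟨Real.log t, ⟨Real.log_pos h1, (Real.log_le_iff_le_exp ht).2 h2⟩, Real.exp_log ht⟩
  have hsub : deHaan L (Real.exp x) - deHaan L 1 = ∫ t in Ioc 1 (Real.exp x), L t / t := by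
    rw [deHaan, deHaan, ← Ioc_union_Ioc_eq_Ioc zero_le_one hex,
      setIntegral_union (Ioc_disjoint_Ioc_of_le le_rfl) measurableSet_Ioc
        (hL_fin 1 one_pos) ((hL_fin _ (Real.exp_pos x)).mono_set (Ioc_subset_Ioc_left zero_le_one))]
    ring
  rw [hsub, ← himg, integral_image_eq_integral_abs_deriv_smul measurableSet_Ioc
    (fun y _ => (Real.hasDerivAt_exp y).hasDerivWithinAt) Real.exp_injective.injOn,
    intervalIntegral.integral_of_le hx]
  refine setIntegral_congr_fun measurableSet_Ioc fun y hy => ?_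
  rw [indicator_of_mem (mem_Ici.2 hy.1.le), abs_of_pos (Real.exp_pos y), smul_eq_mul,
    mul_div_cancel₀ _ (Real.exp_pos y).ne']

lemma reflectCut_indicator_exp (L : ℝ → ℝ) (x : ℝ) :
    reflectCut ((Ici 0).indicator fun y => L (Real.exp y)) x =
      (Ioc 0 x).indicator fun z => L (Real.exp (x - z)) := by
  funext z
  simp only [reflectCut, indicator, mem_Ioi, mem_Ici, mem_Ioc, sub_nonneg]
  split_ifs <;> simp_all

end Exponential

theorem mainTheorem2 {Ω : Type*} [MeasurableSpace Ω] (P : Measure Ω) [IsProbabilityMeasure P]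
    (Z : ℕ → Ω → ℝ) (hZ_meas : ∀ i, Measurable (Z i)) (hZ_indep : iIndepFun Z P)
    (hZ_ident : ∀ i, IdentDistrib (Z i) (Z 0) P P)
    (hZ_int : Integrable (Z 0) P) (hZ_pos : 0 < ∫ ω, Z 0 ω ∂P)
    (hZ_nonarith : ¬ IsArithmetic (P.map (Z 0)))
    (L : ℝ → ℝ) (hL : IsSlowlyVarying L)
    (hL_bdd : ∀ b : ℝ, BddAbove (L '' Icc 1 b))
    (hL_fin : ∀ x : ℝ, 0 < x → IntegrableOn (fun t : ℝ => L t / t) (Ioc 0 x))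
    (hL_top : Tendsto (deHaan L) atTop atTop) :
    (∀ x : ℝ, IntegrableOn (fun z : ℝ => L (Real.exp (x - z))) (Ioc 0 x) (renewalMeasure P Z)) ∧
    (fun x : ℝ => ∫ z in Ioc 0 x, L (Real.exp (x - z)) ∂(renewalMeasure P Z))
      ~[atTop] (fun x : ℝ => deHaan L (Real.exp x) / ∫ ω, Z 0 ω ∂P) := by
  have hf := hL.isAddSlowlyVarying hL_bdd
  have hH := exists_renewalMeasure_Icc_le hZ_meas hZ_indep hZ_ident hZ_int hZ_pos
  have hdH := hL_top.comp Real.tendsto_exp_atTop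
  have hFeq : (fun x => ∫ y in 0..x, (Ici 0).indicator (fun y => L (Real.exp y)) y) =ᶠ[atTop]
      fun x => deHaan L (Real.exp x) - deHaan L 1 := by
    filter_upwards [eventually_ge_atTop 0] with x hx
    exact integral_comp_exp_eq_deHaan_sub hL_fin hx
  have hF := (tendsto_atTop_add_const_right atTop (-deHaan L 1) hdH).congr' hFeq.symm
  refine ⟨fun x => ?_, ?_⟩
  · rcases lt_or_ge x 0 with hx | hx
    · simp [Ioc_eq_empty_of_le hx.le]
    · rw [← integrable_indicator_iff measurableSet_Ioc, ← reflectCut_indicator_exp]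
      simpa using hf.integrable_reflectCut_add hH hx 0
  · have hmain := hf.tendsto_integral_renewalMeasure_div hZ_meas hZ_indep hZ_ident hZ_int hZ_pos hF
    have hratio : Tendsto (fun x => (deHaan L (Real.exp x) - deHaan L 1) / deHaan L (Real.exp x))
        atTop (𝓝 1) := by
      have h := (hdH.const_div_atTop (deHaan L 1)).const_sub 1
      rw [sub_zero] at h
      refine h.congr' ?_
      filter_upwards [hdH.eventually_gt_atTop 0] with x hx
      have hx' : deHaan L (Real.exp x) ≠ 0 := ne_of_gt hx
      simp only [Function.comp]
      rw [sub_div, div_self hx']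
    have hprod := (hmain.mul hratio).mul_const (∫ ω, Z 0 ω ∂P)
    rw [mul_one, inv_mul_cancel₀ hZ_pos.ne'] at hprod
    refine isEquivalent_of_tendsto_one (hprod.congr' ?_)
    filter_upwards [hFeq, hdH.eventually_gt_atTop 0, hdH.eventually_gt_atTop (deHaan L 1)]
      with x hx hx0 hx1
    have hx0' : deHaan L (Real.exp x) ≠ 0 := ne_of_gt hx0
    have hx1' : deHaan L (Real.exp x) - deHaan L 1 ≠ 0 := sub_ne_zero.2 (ne_of_gt hx1)
    have hm := hZ_pos.ne'
    rw [hx, reflectCut_indicator_exp, integral_indicator measurableSet_Ioc]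
    simp only [Pi.div_apply]
    field_simp
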